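/- Let $R>0$ and let $B(R)\subset\mathbb{R}^2$ be the open disk of radius $R$ centred at the origin, with Cartesian coordinates $(u,v)$. Let $$\mathcal{A}=W^{1,2}(B(R))\times W^{1,2}(B(R))\times W^{2,2}(B(R)).$$ For $\mathbf{x}=(f,g,\omega)\in\mathcal{A}$ define the in-plane strains $$\gamma_{11}=2\frac{\partial f}{\partial u}+\Big(\frac{\partial\omega}{\partial u}\Big)^2-\frac{v^2}{3},\qquad \gamma_{12}=\frac{\partial f}{\partial v}+\frac{\partial g}{\partial u}+\frac{\partial\omega}{\partial u}\frac{\partial\omega}{\partial v}+\frac{uv}{3},\qquad \gamma_{22}=2\frac{\partial g}{\partial v}+\Big(\frac{\partial\omega}{\partial v}\Big)^2-\frac{u^2}{3},$$ the stretching energy $S[\mathbf{x}]=\int_{B(R)}(\gamma_{11}^2+2\gamma_{12}^2+\gamma_{22}^2)\,du\,dv$, the bending energy $\mathfrak{B}[\omega]=\int_{B(R)}\|D^2\omega\|^2\,du\,dv$ (with $\|\cdot\|$ the Frobenius norm), the elastic energy $E_t[\mathbf{x}]=S[\mathbf{x}]+t^2\,\mathfrak{B}[\omega]$, and, for $t>0$,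 $F_t[\mathbf{x}]=t^{-2}E_t[\mathbf{x}]$. Let $$F_0[\mathbf{x}]=\begin{cases}\mathfrak{B}[\omega]&\text{if }\gamma_{11}=\gamma_{12}=\gamma_{22}=0\text{ almost everywhere in }B(R),\\ +\infty&\text{otherwise.}\end{cases}$$ Then $F_t$ $\Gamma$-converges sequentially to $F_0$ as $t\to0^+$ with respect to weak convergence in $\mathcal{A}$. That is, for every sequence $t_j>0$ with $t_j\to0$ and every $\mathbf{x}\in\mathcal{A}$: 1. (Liminf inequality) for every sequence $\mathbf{x}_j\rightharpoonup\mathbf{x}$ weakly in $\mathcal{A}$, $F_0[\mathbf{x}]\le\liminf_{j\to\infty}F_{t_j}[\mathbf{x}_j]$; 2. (Recovery sequence) there is a sequence $\mathbf{x}_j\rightharpoonup\mathbf{x}$ weakly in $\mathcal{A}$ with $\limsup_{j\to\infty}F_{t_j}[\mathbf{x}_j]\le F_0[\mathbf{x}]$. -/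

import Mathlib

open MeasureTheory Filter Topology
open scoped ENNReal ContDiff

noncomputable section

namespace SmallSlopes

/-- The Euclidean plane; a point `z` has Cartesian coordinates `u = z 0` and `v = z 1`. -/
abbrev Plane : Type := EuclideanSpace ℝ (Fin 2)

/-- The open disk `B(R)` of radius `R` centred at the origin. -/
abbrev disk (R : ℝ) : Set Plane := Metric.ball (0 : Plane) R

/-- The Hilbert space `L²(Ω)` of real functions, with respect to Lebesgue measure on `Ω`. -/
abbrev L2 (Ω : Set Plane) : Type := Lp ℝ 2 (volume.restrict Ω)

/-- `φ ∈ C_c^∞(Ω)`. -/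
structure IsTestFunction (Ω : Set Plane) (φ : Plane → ℝ) : Prop where
  smooth : ContDiff ℝ ∞ φ
  compact : HasCompactSupport φ
  support : tsupport φ ⊆ Ω

/-- The classical partial derivative `∂φ/∂z_i`. -/
def partialDeriv (i : Fin 2) (φ : Plane → ℝ) (z : Plane) : ℝ :=
  fderiv ℝ φ z (EuclideanSpace.single i 1)

/-- `h` is the weak partial derivative `∂w/∂z_i` on `Ω`:
`∫_Ω w ∂_i φ = - ∫_Ω h φ` for every test function `φ`. -/
def IsWeakPartial (Ω : Set Plane) (i : Fin 2) (w h : L2 Ω) : Prop :=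
  ∀ φ : Plane → ℝ, IsTestFunction Ω φ →
    ∫ z in Ω, w z * partialDeriv i φ z = - ∫ z in Ω, h z * φ z

theorem IsTestFunction.integrable_mul {Ω : Set Plane} {φ : Plane → ℝ}
    (hφ : IsTestFunction Ω φ) (w : L2 Ω) :
    Integrable (fun z => w z * φ z) (volume.restrict Ω) :=
  (Lp.memLp w).integrable_mul (q := 2)
    ((hφ.smooth.continuous.memLp_of_hasCompactSupport hφ.compact).restrict Ω)

theorem IsTestFunction.integrable_mul_partialDeriv {Ω : Set Plane} {φ : Plane → ℝ}
    (hφ : IsTestFunction Ω φ) (i : Fin 2) (w : L2 Ω) :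
    Integrable (fun z => w z * partialDeriv i φ z) (volume.restrict Ω) := by
  have hc : Continuous (partialDeriv i φ) :=
    (hφ.smooth.continuous_fderiv (by simp)).clm_apply continuous_const
  have hs : HasCompactSupport (partialDeriv i φ) :=
    hφ.compact.fderiv_apply ℝ (EuclideanSpace.single i 1)
  exact (Lp.memLp w).integrable_mul (q := 2)
    ((hc.memLp_of_hasCompactSupport hs).restrict Ω)

theorem IsWeakPartial.zero (Ω : Set Plane) (i : Fin 2) :
    IsWeakPartial Ω i (0 : L2 Ω) 0 := by
  intro φ _
  have h0 : ∀ ψ : Plane → ℝ, ∫ z in Ω, (0 : L2 Ω) z * ψ z = 0 := by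
    intro ψ
    rw [integral_eq_zero_of_ae]
    filter_upwards [Lp.coeFn_zero ℝ 2 (volume.restrict Ω)] with z hz
    rw [hz]
    simp
  rw [h0, h0, neg_zero]

theorem IsWeakPartial.add {Ω : Set Plane} {i : Fin 2} {w h w' h' : L2 Ω}
    (H : IsWeakPartial Ω i w h) (H' : IsWeakPartial Ω i w' h') :
    IsWeakPartial Ω i (w + w') (h + h') := by
  intro φ hφ
  have key : ∀ (a b : L2 Ω) (ψ : Plane → ℝ),
      Integrable (fun z => a z * ψ z) (volume.restrict Ω) →
      Integrable (fun z => b z * ψ z) (volume.restrict Ω) →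
      ∫ z in Ω, (a + b) z * ψ z = (∫ z in Ω, a z * ψ z) + ∫ z in Ω, b z * ψ z := by
    intro a b ψ ha hb
    rw [← integral_add ha hb]
    apply integral_congr_ae
    filter_upwards [Lp.coeFn_add a b] with z hz
    rw [hz, Pi.add_apply, add_mul]
  rw [key _ _ _ (hφ.integrable_mul_partialDeriv i w) (hφ.integrable_mul_partialDeriv i w'),
    key _ _ _ (hφ.integrable_mul h) (hφ.integrable_mul h'), H φ hφ, H' φ hφ]
  ring

theorem IsWeakPartial.smul {Ω : Set Plane} {i : Fin 2} {w h : L2 Ω} (c : ℝ)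
    (H : IsWeakPartial Ω i w h) : IsWeakPartial Ω i (c • w) (c • h) := by
  intro φ hφ
  have key : ∀ (a : L2 Ω) (ψ : Plane → ℝ),
      ∫ z in Ω, (c • a) z * ψ z = c * ∫ z in Ω, a z * ψ z := by
    intro a ψ
    rw [← integral_const_mul]
    apply integral_congr_ae
    filter_upwards [Lp.coeFn_smul c a] with z hz
    rw [hz, Pi.smul_apply, smul_eq_mul, mul_assoc]
  rw [key, key, H φ hφ]
  ring

/-- The Hilbert space `W^{1,2}(Ω)`, `Ω` open. An element is an `L²` function `w` listed together
with its weak first derivatives, all in `L²(Ω)`; since weak derivatives are unique, it is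
determined by `w`. The norm is `(‖w‖² + ∑ i, ‖∂_i w‖²)^{1/2}`. -/
def W12 (Ω : Set Plane) :
    Submodule ℝ (WithLp 2 (L2 Ω × PiLp 2 (fun _ : Fin 2 => L2 Ω))) where
  carrier := {p | ∀ i, IsWeakPartial Ω i p.fst (p.snd i)}
  zero_mem' := fun i => IsWeakPartial.zero Ω i
  add_mem' := fun ha hb i => (ha i).add (hb i)
  smul_mem' := fun c _ ha i => (ha i).smul c

/-- The Hilbert space `W^{2,2}(Ω)`, `Ω` open. An element is an `L²` function `w` listed together
with its weak first derivatives `∂_i w` and its weak second derivatives `∂_j ∂_i w` (at the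
index `(i, j)`), all in `L²(Ω)`; since weak derivatives are unique, it is determined by `w`.
The norm is `(‖w‖² + ∑ i, ‖∂_i w‖² + ∑ i, ∑ j, ‖∂_j ∂_i w‖²)^{1/2}`. -/
def W22 (Ω : Set Plane) :
    Submodule ℝ (WithLp 2 (L2 Ω × WithLp 2
      (PiLp 2 (fun _ : Fin 2 => L2 Ω) × PiLp 2 (fun _ : Fin 2 × Fin 2 => L2 Ω)))) where
  carrier := {p | (∀ i, IsWeakPartial Ω i p.fst (p.snd.fst i)) ∧
    ∀ i j, IsWeakPartial Ω j (p.snd.fst i) (p.snd.snd (i, j))}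
  zero_mem' := ⟨fun i => IsWeakPartial.zero Ω i, fun _ j => IsWeakPartial.zero Ω j⟩
  add_mem' := fun ha hb =>
    ⟨fun i => (ha.1 i).add (hb.1 i), fun i j => (ha.2 i j).add (hb.2 i j)⟩
  smul_mem' := fun c _ ha => ⟨fun i => (ha.1 i).smul c, fun i j => (ha.2 i j).smul c⟩

/-- The underlying function of an element of `W^{1,2}(Ω)`. -/
def W12.toL2 {Ω : Set Plane} (w : W12 Ω) : L2 Ω := w.1.fst

/-- The weak derivative `∂_i w` of `w ∈ W^{1,2}(Ω)`. -/
def W12.d {Ω : Set Plane} (i : Fin 2) (w : W12 Ω) : L2 Ω := w.1.snd i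

/-- The underlying function of an element of `W^{2,2}(Ω)`. -/
def W22.toL2 {Ω : Set Plane} (w : W22 Ω) : L2 Ω := w.1.fst

/-- The weak derivative `∂_i w` of `w ∈ W^{2,2}(Ω)`. -/
def W22.d {Ω : Set Plane} (i : Fin 2) (w : W22 Ω) : L2 Ω := w.1.snd.fst i

/-- The weak derivative `∂_j ∂_i w` of `w ∈ W^{2,2}(Ω)`. -/
def W22.dd {Ω : Set Plane} (i j : Fin 2) (w : W22 Ω) : L2 Ω := w.1.snd.snd (i, j)

/-- The space `𝒜 = W^{1,2}(B(R)) × W^{1,2}(B(R)) × W^{2,2}(B(R))` of configurations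
`x = (f, g, ω)`, with its norm topology. -/
abbrev Config (R : ℝ) : Type := W12 (disk R) × W12 (disk R) × W22 (disk R)

variable {R : ℝ}

/-- `γ₁₁ = 2 ∂f/∂u + (∂ω/∂u)² - v²/3`. -/
def gamma11 (x : Config R) (z : Plane) : ℝ :=
  2 * W12.d 0 x.1 z + (W22.d 0 x.2.2 z) ^ 2 - (z 1) ^ 2 / 3

/-- `γ₁₂ = ∂f/∂v + ∂g/∂u + (∂ω/∂u)(∂ω/∂v) + uv/3`. -/
def gamma12 (x : Config R) (z : Plane) : ℝ :=
  W12.d 1 x.1 z + W12.d 0 x.2.1 z + W22.d 0 x.2.2 z * W22.d 1 x.2.2 z + z 0 * z 1 / 3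

/-- `γ₂₂ = 2 ∂g/∂v + (∂ω/∂v)² - u²/3`. -/
def gamma22 (x : Config R) (z : Plane) : ℝ :=
  2 * W12.d 1 x.2.1 z + (W22.d 1 x.2.2 z) ^ 2 - (z 0) ^ 2 / 3

/-- The stretching energy `S[x] = ∫_{B(R)} (γ₁₁² + 2 γ₁₂² + γ₂₂²) du dv`. -/
def stretching (x : Config R) : ℝ≥0∞ :=
  ∫⁻ z in disk R,
    ENNReal.ofReal ((gamma11 x z) ^ 2 + 2 * (gamma12 x z) ^ 2 + (gamma22 x z) ^ 2)

/-- The bending energy `𝔅[ω] = ∫_{B(R)} ‖D²ω‖² du dv`, with the Frobenius norm. -/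
def bending (w : W22 (disk R)) : ℝ≥0∞ :=
  ∫⁻ z in disk R, ENNReal.ofReal (∑ i : Fin 2, ∑ j : Fin 2, (W22.dd i j w z) ^ 2)

/-- The elastic energy `E_t[x] = S[x] + t² 𝔅[x]`. -/
def elasticEnergy (t : ℝ) (x : Config R) : ℝ≥0∞ :=
  stretching x + ENNReal.ofReal (t ^ 2) * bending x.2.2

/-- The functional `F_t[x] = t⁻² E_t[x]` (used for `t > 0`). -/
def scaledEnergy (t : ℝ) (x : Config R) : ℝ≥0∞ :=
  ENNReal.ofReal ((t ^ 2)⁻¹) * elasticEnergy t x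

/-- `γ₁₁ = γ₁₂ = γ₂₂ = 0` almost everywhere in `B(R)`. -/
def StrainFree (x : Config R) : Prop :=
  (∀ᵐ z ∂(volume.restrict (disk R)), gamma11 x z = 0) ∧
  (∀ᵐ z ∂(volume.restrict (disk R)), gamma12 x z = 0) ∧
  (∀ᵐ z ∂(volume.restrict (disk R)), gamma22 x z = 0)

open scoped Classical in
/-- The limit functional: `𝔅[ω]` if all in-plane strains vanish, and `+∞` otherwise. -/
def limitEnergy (x : Config R) : ℝ≥0∞ :=
  if StrainFree x then bending x.2.2 else ⊤

/-- Sequential `Γ`-convergence `Γ-lim_{t → 0⁺} F_t = F₀` on a space `X`: along every sequence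
`t_j > 0` tending to `0` and at every point `x`, the liminf inequality holds for every
sequence converging to `x`, and there is a recovery sequence converging to `x`. -/
def GammaTendsto {X : Type*} [TopologicalSpace X] (F : ℝ → X → ℝ≥0∞) (F₀ : X → ℝ≥0∞) : Prop :=
  ∀ t : ℕ → ℝ, (∀ j, 0 < t j) → Tendsto t atTop (𝓝 0) → ∀ x : X,
    (∀ y : ℕ → X, Tendsto y atTop (𝓝 x) →
      F₀ x ≤ liminf (fun j => F (t j) (y j)) atTop) ∧
    (∃ y : ℕ → X, Tendsto y atTop (𝓝 x) ∧
      limsup (fun j => F (t j) (y j)) atTop ≤ F₀ x)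

end SmallSlopes

end

noncomputable section

namespace SmallSlopes

/-! ### Pairings and weak convergence in L². -/

section L2

variable {Ω : Set Plane}

/-! For t > 0 the factors t² cancel on the bending term, so F_t = t⁻² S + 𝔅. The constant sequence
is therefore a recovery sequence: either S vanishes at the point and F_t = 𝔅 there, or F_0 = ∞.

For the liminf inequality, F_t ≥ 𝔅 and 𝔅 is a squared Hilbert seminorm, hence weakly lower
semicontinuous; this settles strain-free limits. If the limit is not strain-free and the liminf were
finite, S ≤ t² F_t would tend to 0 along a subsequence. That is contradictory once S → 0 forces the
weak limit to be strain-free (`strainFree_of_tendsto_stretching`).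

Each strain is a linear term plus a product of two first derivatives of ω plus a polynomial. Only
the product is delicate. Vanishing almost everywhere can be tested against C_c^∞ functions, so a
local compactness statement suffices (`tendsto_integral_mul_mul`): if h_j and its weak gradient
converge weakly and k_j converges weakly, then ∫ h_j k_j φ converges to the expected limit. After
subtracting the limit of h_j and replacing k_j by smooth g_j, φ g_j is mollified at a fixed scale ε.
The error is O(ε) uniformly in j, because derivatives can be moved onto h_j; the mollified functions
converge boundedly and pointwise, hence strongly in L², and pair to 0 with a weakly null sequence.
-/

theorem integrable_mul (h : L2 Ω) {f : Plane → ℝ} (hf : MemLp f 2 (volume.restrict Ω)) :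
    Integrable (fun z => h z * f z) (volume.restrict Ω) :=
  (Lp.memLp h).integrable_mul (q := 2) hf

theorem integral_mul_eq_inner (h : L2 Ω) {f : Plane → ℝ} (hf : MemLp f 2 (volume.restrict Ω)) :
    ∫ z in Ω, h z * f z = inner ℝ (hf.toLp f) h := by
  rw [L2.inner_def]
  apply integral_congr_ae
  filter_upwards [hf.coeFn_toLp] with z hz
  simp [hz]

theorem abs_integral_mul_le (h : L2 Ω) {f : Plane → ℝ} (hf : MemLp f 2 (volume.restrict Ω)) :
    |∫ z in Ω, h z * f z| ≤ ‖h‖ * (eLpNorm f 2 (volume.restrict Ω)).toReal := by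
  rw [integral_mul_eq_inner h hf]
  refine (abs_real_inner_le_norm _ _).trans ?_
  rw [Lp.norm_toLp, mul_comm]

/-- Weak convergence of a sequence in `L²(Ω)`. -/
def WeaklyTendsto (w : ℕ → L2 Ω) (w₀ : L2 Ω) : Prop :=
  ∀ v : L2 Ω, Tendsto (fun j => inner ℝ v (w j)) atTop (𝓝 (inner ℝ v w₀))

theorem WeaklyTendsto.integral_mul {w : ℕ → L2 Ω} {w₀ : L2 Ω} (hw : WeaklyTendsto w w₀)
    {f : Plane → ℝ} (hf : MemLp f 2 (volume.restrict Ω)) :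
    Tendsto (fun j => ∫ z in Ω, w j z * f z) atTop (𝓝 (∫ z in Ω, w₀ z * f z)) := by
  simp_rw [integral_mul_eq_inner _ hf]
  exact hw _

theorem WeaklyTendsto.bounded {w : ℕ → L2 Ω} {w₀ : L2 Ω} (hw : WeaklyTendsto w w₀) :
    ∃ C, ∀ j, ‖w j‖ ≤ C := by
  obtain ⟨C, hC⟩ := banach_steinhaus (g := fun j => innerSL ℝ (w j)) (fun v => by
    obtain ⟨C, hC⟩ := (hw v).norm.bddAbove_range
    refine ⟨C, fun j => ?_⟩
    rw [innerSL_apply_apply, real_inner_comm]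
    exact hC ⟨j, rfl⟩)
  exact ⟨C, fun j => by simpa using hC j⟩

theorem WeaklyTendsto.sub {w w' : ℕ → L2 Ω} {w₀ w₀' : L2 Ω} (hw : WeaklyTendsto w w₀)
    (hw' : WeaklyTendsto w' w₀') : WeaklyTendsto (fun j => w j - w' j) (w₀ - w₀') := fun v => by
  simpa only [inner_sub_right] using (hw v).sub (hw' v)

theorem weaklyTendsto_const (w₀ : L2 Ω) : WeaklyTendsto (fun _ => w₀) w₀ :=
  fun _ => tendsto_const_nhds

/-- Allows a weakly convergent sequence to be replaced by smooth approximants. -/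
theorem WeaklyTendsto.of_norm_sub {w w' : ℕ → L2 Ω} {w₀ : L2 Ω} (hw : WeaklyTendsto w w₀)
    (h : Tendsto (fun j => ‖w j - w' j‖) atTop (𝓝 0)) : WeaklyTendsto w' w₀ := fun v => by
  have h1 : Tendsto (fun j => inner ℝ v (w j - w' j)) atTop (𝓝 0) := by
    refine squeeze_zero_norm (fun j => norm_inner_le_norm v _) ?_
    simpa using h.const_mul ‖v‖
  simpa [inner_sub_right] using (hw v).sub h1

theorem IsWeakPartial.sub {i : Fin 2} {w h w' h' : L2 Ω}
    (H : IsWeakPartial Ω i w h) (H' : IsWeakPartial Ω i w' h') :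
    IsWeakPartial Ω i (w - w') (h - h') := by
  simpa [sub_eq_add_neg] using H.add (H'.smul (-1))

end L2

/-! ### Translates of test functions paired with a Sobolev function. -/

section Translation

variable {Ω : Set Plane}

theorem translate_isTestFunction {ψ : Plane → ℝ} (hs : ContDiff ℝ ∞ ψ)
    (hc : HasCompactSupport ψ) {y : Plane} (hy : ∀ z ∈ tsupport ψ, z + y ∈ Ω) :
    IsTestFunction Ω (fun z => ψ (z - y)) := by
  have h1 : (fun z => ψ (z - y)) = ψ ∘ Homeomorph.subRight y := rfl
  refine ⟨hs.comp (contDiff_id.sub contDiff_const), ?_, ?_⟩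
  · rw [h1]
    exact hc.comp_homeomorph _
  · intro z hz
    have h2 := tsupport_comp_subset_preimage ψ (f := fun z : Plane => z - y) (by fun_prop) hz
    simpa using hy _ h2

theorem fderiv_eq_sum_partialDeriv (φ : Plane → ℝ) (z y : Plane) :
    fderiv ℝ φ z y = y 0 * partialDeriv 0 φ z + y 1 * partialDeriv 1 φ z := by
  have : y = y 0 • EuclideanSpace.single 0 (1 : ℝ) + y 1 • EuclideanSpace.single 1 (1 : ℝ) := by
    ext i
    fin_cases i <;> simp
  conv_lhs => rw [this]
  simp [partialDeriv]

theorem partialDeriv_translate (i : Fin 2) (ψ : Plane → ℝ) (y z : Plane) :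
    partialDeriv i (fun z => ψ (z - y)) z = partialDeriv i ψ (z - y) := by
  simp only [partialDeriv]
  rw [fderiv_comp_sub]

theorem eLpNorm_translate_le {ψ : Plane → ℝ} (hψ : Continuous ψ) (y : Plane) :
    eLpNorm (fun z => ψ (z - y)) 2 (volume.restrict Ω) ≤ eLpNorm ψ 2 volume := by
  refine (eLpNorm_mono_measure _ Measure.restrict_le_self).trans ?_
  exact (eLpNorm_comp_measurePreserving (p := 2) hψ.aestronglyMeasurable
    (measurePreserving_sub_right volume y)).le

/-- The translate of ψ is a test function on Ω, so the derivative moves onto h and Cauchy–Schwarz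
applies. The bound involves the L² norm of ψ but not its gradient, which keeps it uniform over rough
sequences of ψ. -/
theorem abs_integral_mul_fderiv_translate_le {h d₀ d₁ : L2 Ω} (H₀ : IsWeakPartial Ω 0 h d₀)
    (H₁ : IsWeakPartial Ω 1 h d₁) {ψ : Plane → ℝ} (hs : ContDiff ℝ ∞ ψ)
    (hc : HasCompactSupport ψ) {y : Plane} (hy : ∀ z ∈ tsupport ψ, z + y ∈ Ω) (v : Plane) :
    |∫ z in Ω, h z * fderiv ℝ ψ (z - y) v| ≤
      ‖v‖ * ((‖d₀‖ + ‖d₁‖) * (eLpNorm ψ 2 volume).toReal) := by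
  have ht := translate_isTestFunction hs hc hy
  have hN : eLpNorm ψ 2 volume ≠ ⊤ :=
    (hs.continuous.memLp_of_hasCompactSupport hc).eLpNorm_ne_top
  have hm : MemLp (fun z => ψ (z - y)) 2 (volume.restrict Ω) :=
    (ht.smooth.continuous.memLp_of_hasCompactSupport ht.compact).restrict Ω
  have hd : ∀ d : L2 Ω, |∫ z in Ω, d z * ψ (z - y)| ≤ ‖d‖ * (eLpNorm ψ 2 volume).toReal :=
    fun d => (abs_integral_mul_le d hm).trans (mul_le_mul_of_nonneg_left
      (ENNReal.toReal_mono hN (eLpNorm_translate_le hs.continuous y)) (norm_nonneg _))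
  have h1 : ∫ z in Ω, h z * fderiv ℝ ψ (z - y) v =
      v 0 * -(∫ z in Ω, d₀ z * ψ (z - y)) + v 1 * -(∫ z in Ω, d₁ z * ψ (z - y)) := by
    rw [← H₀ _ ht, ← H₁ _ ht, ← integral_const_mul, ← integral_const_mul, ← integral_add
      ((ht.integrable_mul_partialDeriv 0 h).const_mul _)
      ((ht.integrable_mul_partialDeriv 1 h).const_mul _)]
    refine integral_congr_ae (Eventually.of_forall fun z => ?_)
    simp only [partialDeriv_translate, fderiv_eq_sum_partialDeriv ψ (z - y) v]
    ring
  have hv : ∀ i, |v i| ≤ ‖v‖ := fun i => by simpa using PiLp.norm_apply_le v i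
  rw [h1]
  refine (abs_add_le _ _).trans ?_
  rw [abs_mul, abs_mul, abs_neg, abs_neg]
  have := mul_le_mul (hv 0) (hd d₀) (abs_nonneg _) (norm_nonneg _)
  have := mul_le_mul (hv 1) (hd d₁) (abs_nonneg _) (norm_nonneg _)
  linarith

/-- A translation by `y` changes the pairing with `h` by at most `‖y‖ ‖∇h‖`. -/
theorem abs_integral_mul_sub_translate_le [IsFiniteMeasure (volume.restrict Ω)]
    {h d₀ d₁ : L2 Ω} (H₀ : IsWeakPartial Ω 0 h d₀)
    (H₁ : IsWeakPartial Ω 1 h d₁) {ψ : Plane → ℝ} (hs : ContDiff ℝ ∞ ψ)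
    (hc : HasCompactSupport ψ) {y : Plane}
    (hy : ∀ s ∈ Set.Icc (0 : ℝ) 1, ∀ z ∈ tsupport ψ, z + s • y ∈ Ω) :
    |∫ z in Ω, h z * (ψ z - ψ (z - y))| ≤
      ‖y‖ * ((‖d₀‖ + ‖d₁‖) * (eLpNorm ψ 2 volume).toReal) := by
  have hcf : Continuous (fderiv ℝ ψ) := hs.continuous_fderiv (by simp)
  obtain ⟨C, hC⟩ := (hc.fderiv ℝ).exists_bound_of_continuous hcf
  obtain ⟨C', hC'⟩ := hc.exists_bound_of_continuous hs.continuous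
  have hint : Integrable h (volume.restrict Ω) :=
    (Lp.memLp h).integrable (by norm_num)
  have hψi : ∀ y, Integrable (fun z => h z * ψ (z - y)) (volume.restrict Ω) := fun y =>
    hint.mul_bdd (c := C') (hs.continuous.comp (by fun_prop)).aestronglyMeasurable
      (Eventually.of_forall fun z => hC' _)
  have hcv : ∀ (s : ℝ) (v : Plane), Continuous (fun z => fderiv ℝ ψ (z - s • y) v) := fun s v =>
    (hcf.comp (by fun_prop : Continuous fun z : Plane => z - s • y)).clm_apply continuous_const
  have hderiv : ∀ s : ℝ, HasDerivAt (fun s : ℝ => ∫ z in Ω, h z * ψ (z - s • y))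
      (∫ z in Ω, h z * fderiv ℝ ψ (z - s • y) (-y)) s := by
    intro s
    refine (hasDerivAt_integral_of_dominated_loc_of_deriv_le (μ := volume.restrict Ω)
      (F := fun (s : ℝ) z => h z * ψ (z - s • y))
      (F' := fun s z => h z * fderiv ℝ ψ (z - s • y) (-y))
      (bound := fun z => ‖h z‖ * (C * ‖y‖)) (s := Set.univ) univ_mem
      (Eventually.of_forall fun s => (hψi (s • y)).aestronglyMeasurable) (hψi _) ?_ ?_ ?_ ?_).2
    · exact hint.aestronglyMeasurable.mul (hcv s _).aestronglyMeasurable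
    · refine Eventually.of_forall fun z s _ => ?_
      rw [norm_mul]
      gcongr
      refine (ContinuousLinearMap.le_opNorm _ _).trans ?_
      rw [norm_neg]
      gcongr
      exact hC _
    · exact hint.norm.mul_const _
    · refine Eventually.of_forall fun z s _ => ?_
      have h1 : HasDerivAt (fun s : ℝ => z - s • y) (-y) s := by
        simpa using ((hasDerivAt_id s).smul_const y).const_sub z
      exact ((((hs.differentiable (by simp)) _).hasFDerivAt).comp_hasDerivAt s h1).const_mul _
  -- Mean value inequality for s ↦ ∫ h ψ(· - s y) on [0, 1]; `hy` keeps every intermediate translate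
  -- supported in Ω.
  have hmv := norm_image_sub_le_of_norm_deriv_le_segment_01'
    (f := fun s : ℝ => ∫ z in Ω, h z * ψ (z - s • y))
    (f' := fun s => ∫ z in Ω, h z * fderiv ℝ ψ (z - s • y) (-y))
    (C := ‖y‖ * ((‖d₀‖ + ‖d₁‖) * (eLpNorm ψ 2 volume).toReal))
    (fun s _ => (hderiv s).hasDerivWithinAt) (fun s hss => by
      have := abs_integral_mul_fderiv_translate_le H₀ H₁ hs hc
        (hy s (Set.Ico_subset_Icc_self hss)) (-y)
      rwa [norm_neg] at this)
  have h0 := hψi 0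
  simp only [sub_zero] at h0
  simp only [one_smul, zero_smul, sub_zero] at hmv
  rw [norm_sub_rev, ← integral_sub h0 (hψi y)] at hmv
  simpa only [mul_sub, Real.norm_eq_abs] using hmv

end Translation

/-! ### Mollification error, and pairing weak with strong convergence. -/

section Mollification

variable {Ω : Set Plane}

/-- Mollification with a kernel of radius `ε` changes the pairing with `h` by at most `ε ‖∇h‖`. -/
theorem abs_integral_mul_sub_mollify_le [IsFiniteMeasure (volume.restrict Ω)]
    {h d₀ d₁ : L2 Ω} (H₀ : IsWeakPartial Ω 0 h d₀) (H₁ : IsWeakPartial Ω 1 h d₁)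
    {ψ : Plane → ℝ} (hs : ContDiff ℝ ∞ ψ) (hc : HasCompactSupport ψ)
    {η : Plane → ℝ} (hηc : Continuous η) (hηs : HasCompactSupport η) (hη0 : ∀ y, 0 ≤ η y)
    (hη1 : ∫ y, η y = 1) {ε : ℝ} (hε : ∀ y, η y ≠ 0 → ‖y‖ ≤ ε)
    (hΩ : ∀ z ∈ tsupport ψ, ∀ y : Plane, ‖y‖ ≤ ε → z + y ∈ Ω) :
    |∫ z in Ω, h z * (ψ z - ∫ y, η y * ψ (z - y))| ≤
      ε * ((‖d₀‖ + ‖d₁‖) * (eLpNorm ψ 2 volume).toReal) := by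
  set X := (‖d₀‖ + ‖d₁‖) * (eLpNorm ψ 2 volume).toReal with hX
  have hX0 : 0 ≤ X := by positivity
  obtain ⟨C, hC⟩ := hc.exists_bound_of_continuous hs.continuous
  have hηi : Integrable η := hηc.integrable_of_hasCompactSupport hηs
  have hint : Integrable h (volume.restrict Ω) := (Lp.memLp h).integrable (by norm_num)
  have hψy : ∀ z, Integrable (fun y => η y * ψ (z - y)) := fun z =>
    hηi.mul_bdd (c := C) (hs.continuous.comp (by fun_prop)).aestronglyMeasurable
      (Eventually.of_forall fun y => hC _)
  -- Since η has mass one, the mollification error is the η-average of translation errors; Fubini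
  -- then reduces to one translation at a time.
  have h1 : ∀ z, h z * (ψ z - ∫ y, η y * ψ (z - y)) =
      ∫ y, η y * (h z * (ψ z - ψ (z - y))) := by
    intro z
    have : ψ z = ∫ y, η y * ψ z := by rw [integral_mul_const, hη1, one_mul]
    conv_lhs => rw [this]
    rw [← integral_sub (hηi.mul_const _) (hψy z), ← integral_const_mul]
    congr 1
    ext y
    ring
  have hprod : Integrable (Function.uncurry fun (z y : Plane) => η y * (h z * (ψ z - ψ (z - y))))
      ((volume.restrict Ω).prod volume) := by
    have h2 := (hint.mul_prod hηi).mul_bdd (c := C + C)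
      (g := fun p : Plane × Plane => ψ p.1 - ψ (p.1 - p.2))
      (((hs.continuous.comp (by fun_prop)).sub
        (hs.continuous.comp (by fun_prop))).aestronglyMeasurable)
      (Eventually.of_forall fun p => (norm_sub_le _ _).trans (add_le_add (hC _) (hC _)))
    refine h2.congr (Eventually.of_forall fun p => ?_)
    simp only [Function.uncurry]
    ring
  simp_rw [h1]
  rw [integral_integral_swap hprod]
  have h3 : ∀ y, ‖∫ z in Ω, η y * (h z * (ψ z - ψ (z - y)))‖ ≤ η y * (ε * X) := by
    intro y
    rw [integral_const_mul, norm_mul, Real.norm_of_nonneg (hη0 y)]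
    by_cases hy : η y = 0
    · simp [hy]
    refine mul_le_mul_of_nonneg_left ?_ (hη0 y)
    refine (abs_integral_mul_sub_translate_le H₀ H₁ hs hc (y := y) fun s hs' z hz => ?_).trans
      (mul_le_mul_of_nonneg_right (hε y hy) hX0)
    refine hΩ z hz _ ?_
    rw [norm_smul, Real.norm_of_nonneg hs'.1]
    exact (mul_le_of_le_one_left (norm_nonneg _) hs'.2).trans (hε y hy)
  have h4 := norm_integral_le_of_norm_le (hηi.mul_const (ε * X)) (Eventually.of_forall h3)
  rwa [integral_mul_const, hη1, one_mul, Real.norm_eq_abs] at h4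

theorem tendsto_eLpNorm_two_zero {μ : Measure Plane} [IsFiniteMeasure μ] {n : ℕ → Plane → ℝ}
    (hm : ∀ j, StronglyMeasurable (n j)) {B : ℝ} (hB : ∀ j z, ‖n j z‖ ≤ B)
    (ht : ∀ z, Tendsto (fun j => n j z) atTop (𝓝 0)) :
    Tendsto (fun j => eLpNorm (n j) 2 μ) atTop (𝓝 0) := by
  have h1 : Tendsto (fun j => ∫⁻ z, ‖n j z‖ₑ ^ (2 : ℝ) ∂μ) atTop (𝓝 (∫⁻ _, 0 ∂μ)) := by
    refine tendsto_lintegral_of_dominated_convergence (fun _ => ENNReal.ofReal B ^ (2 : ℝ))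
      (fun j => (hm j).measurable.enorm.pow_const _) (fun j => Eventually.of_forall fun z => ?_)
      ?_ (Eventually.of_forall fun z => ?_)
    · dsimp only
      gcongr
      rw [← ofReal_norm]
      exact ENNReal.ofReal_le_ofReal (hB j z)
    · rw [lintegral_const]
      exact ENNReal.mul_ne_top (by simp) (measure_ne_top _ _)
    · have := ((ENNReal.continuous_rpow_const (y := 2)).tendsto _).comp (ht z).enorm
      simpa [Function.comp_def] using this
  rw [lintegral_zero] at h1
  have h2 := ((ENNReal.continuous_rpow_const (y := 1 / 2)).tendsto _).comp h1
  simpa [Function.comp_def, eLpNorm_eq_lintegral_rpow_enorm_toReal (p := 2)] using h2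

/-- Bounded pointwise convergence on a finite measure space is strong L² convergence. The difference
n_j - n₀ is absorbed by the bound on ‖h_j‖, and the fixed n₀ by weak convergence. -/
theorem WeaklyTendsto.tendsto_integral_mul_of_pointwise [IsFiniteMeasure (volume.restrict Ω)]
    {h : ℕ → L2 Ω} (hh : WeaklyTendsto h 0) {n : ℕ → Plane → ℝ} {n₀ : Plane → ℝ}
    (hm : ∀ j, StronglyMeasurable (n j)) (hm₀ : StronglyMeasurable n₀) {B : ℝ}
    (hB : ∀ j z, ‖n j z‖ ≤ B) (hB₀ : ∀ z, ‖n₀ z‖ ≤ B)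
    (ht : ∀ z, Tendsto (fun j => n j z) atTop (𝓝 (n₀ z))) :
    Tendsto (fun j => ∫ z in Ω, h j z * n j z) atTop (𝓝 0) := by
  have hL : ∀ {f : Plane → ℝ} {c : ℝ}, StronglyMeasurable f → (∀ z, ‖f z‖ ≤ c) →
      MemLp f 2 (volume.restrict Ω) := fun hf hc =>
    MemLp.of_bound hf.aestronglyMeasurable _ (Eventually.of_forall hc)
  have hdB : ∀ j z, ‖n j z - n₀ z‖ ≤ B + B := fun j z =>
    (norm_sub_le _ _).trans (add_le_add (hB j z) (hB₀ z))
  have hdm : ∀ j, StronglyMeasurable fun z => n j z - n₀ z := fun j => (hm j).sub hm₀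
  have hd := tendsto_eLpNorm_two_zero (μ := volume.restrict Ω) hdm hdB fun z => by
    simpa using (ht z).sub_const (n₀ z)
  obtain ⟨M, hM⟩ := hh.bounded
  have h1 : Tendsto (fun j => ∫ z in Ω, h j z * (n j z - n₀ z)) atTop (𝓝 0) := by
    refine squeeze_zero_norm (fun j => (abs_integral_mul_le (h j) (hL (hdm j) (hdB j))).trans
      (mul_le_mul_of_nonneg_right (hM j) ENNReal.toReal_nonneg)) ?_
    simpa using ((ENNReal.tendsto_toReal ENNReal.zero_ne_top).comp hd).const_mul M
  have h2 := h1.add (hh.integral_mul (hL hm₀ hB₀))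
  have h3 : ∫ z in Ω, (0 : L2 Ω) z * n₀ z = 0 := by
    rw [integral_mul_eq_inner _ (hL hm₀ hB₀), inner_zero_right]
  rw [h3, add_zero] at h2
  refine h2.congr fun j => ?_
  rw [← integral_add (integrable_mul (h j) (hL (hdm j) (hdB j))) (integrable_mul (h j) (hL hm₀ hB₀))]
  congr 1
  ext z
  ring

end Mollification

/-! ### Local compactness of W^{1,2} in L². -/

section Compactness

variable {Ω : Set Plane}

/-- The mollification of a test function times `g` only depends on the class of `g` in `L²(Ω)`. -/
theorem mollify_eq_setIntegral {φ : Plane → ℝ} (hφ : IsTestFunction Ω φ) (η g : Plane → ℝ)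
    {G : L2 Ω} (hG : G =ᵐ[volume.restrict Ω] g) (z : Plane) :
    ∫ y, η y * (φ (z - y) * g (z - y)) = ∫ y in Ω, G y * (η (z - y) * φ y) := by
  rw [← integral_sub_left_eq_self (fun y => η y * (φ (z - y) * g (z - y))) volume z,
    ← setIntegral_eq_integral_of_forall_compl_eq_zero (s := Ω)]
  · refine integral_congr_ae ?_
    filter_upwards [hG] with y hy
    rw [hy, sub_sub_cancel]
    ring
  · intro y hy
    rw [sub_sub_cancel, image_eq_zero_of_notMem_tsupport fun h => hy (hφ.support h)]
    simp

theorem memLp_mollifier_mul {φ η : Plane → ℝ}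
    (hφ : IsTestFunction Ω φ) (hηc : Continuous η) (z : Plane) :
    MemLp (fun y => η (z - y) * φ y) 2 (volume.restrict Ω) :=
  (((hηc.comp (by fun_prop)).mul hφ.smooth.continuous).memLp_of_hasCompactSupport
    hφ.compact.mul_left).restrict Ω

theorem stronglyMeasurable_mollify {φ η : Plane → ℝ} (hφ : IsTestFunction Ω φ)
    (hηc : Continuous η) (w : L2 Ω) :
    StronglyMeasurable fun z => ∫ y in Ω, w y * (η (z - y) * φ y) := by
  have hcont : Continuous fun p : Plane × Plane => η (p.1 - p.2) * φ p.2 :=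
    (hηc.comp (by fun_prop)).mul (hφ.smooth.continuous.comp continuous_snd)
  exact StronglyMeasurable.integral_prod_right
    (((Lp.stronglyMeasurable w).comp_measurable measurable_snd).mul hcont.stronglyMeasurable)

/-- Supplies the dominating constant. It depends on the kernel, which is harmless because the kernel
is fixed before j → ∞. -/
theorem exists_norm_mollify_le [IsFiniteMeasure (volume.restrict Ω)] {φ η : Plane → ℝ}
    (hφ : IsTestFunction Ω φ) (hηc : Continuous η) (hηs : HasCompactSupport η) :
    ∃ N, 0 ≤ N ∧ ∀ (w : L2 Ω) z, ‖∫ y in Ω, w y * (η (z - y) * φ y)‖ ≤ ‖w‖ * N := by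
  obtain ⟨Cη, hCη⟩ := hηs.exists_bound_of_continuous hηc
  obtain ⟨Cφ, hCφ⟩ := hφ.compact.exists_bound_of_continuous hφ.smooth.continuous
  refine ⟨(eLpNorm (fun _ : Plane => Cη * Cφ) 2 (volume.restrict Ω)).toReal,
    ENNReal.toReal_nonneg, fun w z => ?_⟩
  refine (abs_integral_mul_le w (memLp_mollifier_mul hφ hηc z)).trans
    (mul_le_mul_of_nonneg_left
      (ENNReal.toReal_mono (memLp_const _).eLpNorm_ne_top ?_) (norm_nonneg _))
  refine eLpNorm_mono fun y => ?_
  rw [norm_mul]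
  exact (mul_le_mul (hCη _) (hCφ _) (norm_nonneg _) ((norm_nonneg _).trans (hCη 0))).trans
    (le_abs_self _)

/-- For fixed z the inner integral pairs G_j with a fixed L² function, so weak convergence of G_j
becomes pointwise convergence in z. -/
theorem tendsto_integral_mul_mollify [IsFiniteMeasure (volume.restrict Ω)] {h : ℕ → L2 Ω}
    (hh : WeaklyTendsto h 0) {G : ℕ → L2 Ω} {G₀ : L2 Ω} (hG : WeaklyTendsto G G₀)
    {φ η : Plane → ℝ} (hφ : IsTestFunction Ω φ) (hηc : Continuous η) (hηs : HasCompactSupport η) :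
    Tendsto (fun j => ∫ z in Ω, h j z * ∫ y in Ω, G j y * (η (z - y) * φ y)) atTop (𝓝 0) := by
  obtain ⟨M, hM⟩ := hG.bounded
  obtain ⟨N, hN0, hN⟩ := exists_norm_mollify_le hφ hηc hηs
  refine hh.tendsto_integral_mul_of_pointwise (B := max M ‖G₀‖ * N)
    (fun j => stronglyMeasurable_mollify hφ hηc (G j)) (stronglyMeasurable_mollify hφ hηc G₀)
    (fun j z => (hN _ _).trans ?_) (fun z => (hN _ _).trans ?_)
    fun z => hG.integral_mul (memLp_mollifier_mul hφ hηc z)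
  · gcongr
    exact (hM j).trans (le_max_left _ _)
  · gcongr
    exact le_max_right _ _

theorem eLpNorm_testFunction_mul_le {φ : Plane → ℝ} (hΩ : MeasurableSet Ω)
    (hφ : IsTestFunction Ω φ) {C : ℝ} (hC : ∀ z, ‖φ z‖ ≤ C) {g : Plane → ℝ} {G : L2 Ω}
    (hG : G =ᵐ[volume.restrict Ω] g) :
    (eLpNorm (fun z => φ z * g z) 2 volume).toReal ≤ C * ‖G‖ := by
  have h1 : Ω.indicator (fun z => φ z * g z) = fun z => φ z * g z := by
    refine Set.indicator_eq_self.2 fun z hz => hφ.support (subset_tsupport _ fun h => hz ?_)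
    simp [h]
  rw [← h1, eLpNorm_indicator_eq_eLpNorm_restrict hΩ, Lp.norm_def,
    ← ENNReal.toReal_ofReal ((norm_nonneg _).trans (hC 0)), ← ENNReal.toReal_mul]
  refine ENNReal.toReal_mono
    (ENNReal.mul_ne_top ENNReal.ofReal_ne_top (Lp.memLp G).eLpNorm_ne_top) ?_
  refine eLpNorm_le_mul_eLpNorm_of_ae_le_mul ?_ 2
  filter_upwards [hG] with z hz
  rw [norm_mul, hz]
  exact mul_le_mul_of_nonneg_right (hC z) (norm_nonneg _)

/-- Fixing the mollification scale first makes the error less than e/2 for all j at once; the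
mollified pairing is then less than e/2 for large j. -/
theorem tendsto_integral_mul_testFunction_mul_smooth [IsFiniteMeasure (volume.restrict Ω)]
    (hΩ : IsOpen Ω) {h : ℕ → L2 Ω} (hh : WeaklyTendsto h 0) {d₀ d₁ : ℕ → L2 Ω}
    (H₀ : ∀ j, IsWeakPartial Ω 0 (h j) (d₀ j)) (H₁ : ∀ j, IsWeakPartial Ω 1 (h j) (d₁ j))
    {D : ℝ} (hD : ∀ j, ‖d₀ j‖ + ‖d₁ j‖ ≤ D) {φ : Plane → ℝ} (hφ : IsTestFunction Ω φ)
    {G : ℕ → L2 Ω} {G₀ : L2 Ω} (hG : WeaklyTendsto G G₀) {g : ℕ → Plane → ℝ}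
    (hGg : ∀ j, G j =ᵐ[volume.restrict Ω] g j) (hg : ∀ j, ContDiff ℝ ∞ (g j)) :
    Tendsto (fun j => ∫ z in Ω, h j z * (φ z * g j z)) atTop (𝓝 0) := by
  obtain ⟨C, hC⟩ := hφ.compact.exists_bound_of_continuous hφ.smooth.continuous
  obtain ⟨M, hM⟩ := hG.bounded
  obtain ⟨δ, hδ, hδΩ⟩ := hφ.compact.isCompact.exists_cthickening_subset_open hΩ hφ.support
  have hC0 : 0 ≤ C := (norm_nonneg _).trans (hC 0)
  have hM0 : 0 ≤ M := (norm_nonneg _).trans (hM 0)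
  have hD0 : 0 ≤ D := (add_nonneg (norm_nonneg _) (norm_nonneg _)).trans (hD 0)
  set X := D * (C * M)
  have hX : 0 ≤ X := by positivity
  rw [Metric.tendsto_atTop]
  intro e he
  -- The bound δ keeps translates of the support of φ inside Ω. As X bounds gradient norm times ‖φ
  -- g_j‖, the other bound gives ε X < e/2; the +1 covers X = 0.
  set ε := min δ (e / (2 * (X + 1)))
  have hε : 0 < ε := lt_min hδ (by positivity)
  let b : ContDiffBump (0 : Plane) := ⟨ε / 2, ε, by positivity, by linarith⟩
  have hηc : Continuous (b.normed volume) := b.continuous_normed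
  have hηs : HasCompactSupport (b.normed volume) := b.hasCompactSupport_normed
  obtain ⟨J, hJ⟩ := Metric.tendsto_atTop.1
    (tendsto_integral_mul_mollify hh hG hφ hηc hηs) (e / 2) (by positivity)
  refine ⟨J, fun j hj => ?_⟩
  have hψs : ContDiff ℝ ∞ fun z => φ z * g j z := hφ.smooth.mul (hg j)
  have hψc : HasCompactSupport fun z => φ z * g j z := hφ.compact.mul_right
  have hψt : tsupport (fun z => φ z * g j z) ⊆ tsupport φ := tsupport_mul_subset_left
  have h1 := abs_integral_mul_sub_mollify_le (H₀ j) (H₁ j) hψs hψc hηc hηs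
    (fun y => b.nonneg_normed y) b.integral_normed (ε := ε) (fun y hy => by
      have : y ∈ Function.support (b.normed volume) := hy
      rw [b.support_normed_eq] at this
      exact (mem_ball_zero_iff.1 this).le) (fun z hz y hy => hδΩ (by
        refine Metric.mem_cthickening_of_dist_le _ z _ _ (hψt hz) ?_
        simpa using hy.trans (min_le_left _ _)))
  have h2 : ε * ((‖d₀ j‖ + ‖d₁ j‖) * (eLpNorm (fun z => φ z * g j z) 2 volume).toReal) < e / 2 := by
    have h3 : (eLpNorm (fun z => φ z * g j z) 2 volume).toReal ≤ C * M :=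
      (eLpNorm_testFunction_mul_le hΩ.measurableSet hφ hC (hGg j)).trans
        (mul_le_mul_of_nonneg_left (hM j) hC0)
    calc _ ≤ e / (2 * (X + 1)) * X :=
          mul_le_mul (min_le_right _ _) (mul_le_mul (hD j) h3 ENNReal.toReal_nonneg hD0)
            (by positivity) (by positivity)
      _ < e / 2 := by
          rw [div_mul_eq_mul_div, div_lt_div_iff₀ (by positivity) (by positivity)]
          nlinarith
  have h4 := hJ j hj
  simp_rw [mollify_eq_setIntegral hφ _ (g j) (hGg j)] at h1
  obtain ⟨N, -, hN⟩ := exists_norm_mollify_le hφ hηc hηs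
  have hmi := integrable_mul (h j) (MemLp.of_bound (p := 2)
    (stronglyMeasurable_mollify hφ hηc (G j)).aestronglyMeasurable _
    (Eventually.of_forall (hN (G j))))
  have hψi := integrable_mul (h j)
    ((hψs.continuous.memLp_of_hasCompactSupport (p := 2) hψc).restrict Ω)
  simp_rw [mul_sub] at h1
  rw [integral_sub hψi hmi] at h1
  rw [Real.dist_eq, sub_zero] at h4 ⊢
  rw [abs_le] at h1
  rw [abs_lt] at h4 ⊢
  constructor <;> linarith

/-- Needed because the translation estimate requires a smooth test function, while k is only in L².
-/
theorem exists_smooth_norm_sub_le [IsFiniteMeasure (volume.restrict Ω)] (k : L2 Ω) {ε : ℝ}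
    (hε : 0 < ε) : ∃ (G : L2 Ω) (g : Plane → ℝ),
      G =ᵐ[volume.restrict Ω] g ∧ ContDiff ℝ ∞ g ∧ ‖k - G‖ ≤ ε := by
  obtain ⟨G, h3, g, h1, -, h2⟩ := Metric.dense_iff.1
    (Lp.dense_hasCompactSupport_contDiff (E := Plane) (F := ℝ) (μ := volume.restrict Ω)
      (p := 2) (by norm_num)) k ε hε
  exact ⟨G, g, h1, h2, by
    rw [← dist_eq_norm, dist_comm]
    exact (Metric.mem_ball.1 h3).le⟩

theorem IsTestFunction.memLp_mul {φ : Plane → ℝ} (hφ : IsTestFunction Ω φ) (w : L2 Ω) :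
    MemLp (fun z => φ z * w z) 2 (volume.restrict Ω) := by
  obtain ⟨C, hC⟩ := hφ.compact.exists_bound_of_continuous hφ.smooth.continuous
  refine (Lp.memLp w).of_le_mul (c := C)
    (hφ.smooth.continuous.aestronglyMeasurable.mul (Lp.aestronglyMeasurable w))
    (Eventually.of_forall fun z => ?_)
  rw [norm_mul]
  exact mul_le_mul_of_nonneg_right (hC z) (norm_nonneg _)

theorem IsTestFunction.exists_abs_integral_mul_le {φ : Plane → ℝ} (hφ : IsTestFunction Ω φ) :
    ∃ C, 0 ≤ C ∧ ∀ h w : L2 Ω, |∫ z in Ω, h z * (φ z * w z)| ≤ ‖h‖ * (C * ‖w‖) := by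
  obtain ⟨C, hC⟩ := hφ.compact.exists_bound_of_continuous hφ.smooth.continuous
  refine ⟨C, (norm_nonneg _).trans (hC 0), fun h w => (abs_integral_mul_le h (hφ.memLp_mul w)).trans
    (mul_le_mul_of_nonneg_left ?_ (norm_nonneg _))⟩
  rw [Lp.norm_def, ← ENNReal.toReal_ofReal ((norm_nonneg _).trans (hC 0)), ← ENNReal.toReal_mul]
  refine ENNReal.toReal_mono
    (ENNReal.mul_ne_top ENNReal.ofReal_ne_top (Lp.memLp w).eLpNorm_ne_top) ?_
  refine eLpNorm_le_mul_eLpNorm_of_ae_le_mul (Eventually.of_forall fun z => ?_) 2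
  rw [norm_mul]
  exact mul_le_mul_of_nonneg_right (hC z) (norm_nonneg _)

/-- Local compactness of `W^{1,2}` in `L²`: products of weakly convergent sequences converge in
the sense of distributions when one of them has bounded weak gradients. -/
theorem tendsto_integral_mul_mul [IsFiniteMeasure (volume.restrict Ω)]
    (hΩ : IsOpen Ω) {h : ℕ → L2 Ω} {h₀ : L2 Ω} (hh : WeaklyTendsto h h₀)
    {d : Fin 2 → ℕ → L2 Ω} {d' : Fin 2 → L2 Ω}
    (H : ∀ i j, IsWeakPartial Ω i (h j) (d i j)) (H' : ∀ i, IsWeakPartial Ω i h₀ (d' i))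
    (hd : ∀ i, WeaklyTendsto (d i) (d' i)) {k : ℕ → L2 Ω} {k₀ : L2 Ω}
    (hk : WeaklyTendsto k k₀) {φ : Plane → ℝ} (hφ : IsTestFunction Ω φ) :
    Tendsto (fun j => ∫ z in Ω, h j z * k j z * φ z) atTop
      (𝓝 (∫ z in Ω, h₀ z * k₀ z * φ z)) := by
  have hpos : ∀ j : ℕ, (0 : ℝ) < 1 / ((j : ℝ) + 1) := fun j => by positivity
  choose G g hGg hg hkG using fun j => exists_smooth_norm_sub_le (k j) (hpos j)
  have hsub0 : Tendsto (fun j => ‖k j - G j‖) atTop (𝓝 0) :=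
    squeeze_zero (fun _ => norm_nonneg _) hkG tendsto_one_div_add_atTop_nhds_zero_nat
  have hG : WeaklyTendsto G k₀ := hk.of_norm_sub hsub0
  have he : WeaklyTendsto (fun j => h j - h₀) 0 := by
    simpa using hh.sub (weaklyTendsto_const h₀)
  obtain ⟨D₀, hD₀⟩ := ((hd 0).sub (weaklyTendsto_const (d' 0))).bounded
  obtain ⟨D₁, hD₁⟩ := ((hd 1).sub (weaklyTendsto_const (d' 1))).bounded
  obtain ⟨E, hE⟩ := he.bounded
  obtain ⟨C, hC0, hC⟩ := hφ.exists_abs_integral_mul_le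
  have h1 := tendsto_integral_mul_testFunction_mul_smooth hΩ he
    (fun j => (H 0 j).sub (H' 0)) (fun j => (H 1 j).sub (H' 1))
    (fun j => add_le_add (hD₀ j) (hD₁ j)) hφ hG hGg hg
  have h2 : Tendsto (fun j => ∫ z in Ω, (h j - h₀) z * (φ z * (k j - G j) z)) atTop (𝓝 0) := by
    refine squeeze_zero_norm (a := fun j => E * (C * ‖k j - G j‖)) (fun j => ?_) ?_
    · refine (hC _ _).trans ?_
      exact mul_le_mul_of_nonneg_right (hE j) (by positivity)
    · simpa using (hsub0.const_mul C).const_mul E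
  have h3 := hk.integral_mul (hφ.memLp_mul h₀)
  -- Uses h_j k_j = (h_j - h₀) G_j + (h_j - h₀)(k_j - G_j) + h₀ k_j: compactness, strong
  -- approximation and weak convergence respectively.
  have h4 := (h1.add h2).add h3
  rw [add_zero, zero_add] at h4
  have e0 : ∫ z in Ω, h₀ z * k₀ z * φ z = ∫ z in Ω, k₀ z * (φ z * h₀ z) := by
    congr 1
    ext z
    ring
  rw [e0]
  refine h4.congr fun j => ?_
  have i1 : Integrable (fun z => (h j - h₀) z * (φ z * g j z)) (volume.restrict Ω) := by
    refine (integrable_mul (h j - h₀) (hφ.memLp_mul (G j))).congr ?_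
    filter_upwards [hGg j] with z hz
    rw [hz]
  have i2 := integrable_mul (h j - h₀) (hφ.memLp_mul (k j - G j))
  have i3 := integrable_mul (k j) (hφ.memLp_mul h₀)
  rw [← integral_add i1 i2]
  refine (integral_add (i1.add i2) i3).symm.trans ?_
  refine integral_congr_ae ?_
  filter_upwards [hGg j, Lp.coeFn_sub (h j) h₀, Lp.coeFn_sub (k j) (G j)] with z e1 e2 e3
  simp only [Pi.add_apply, Pi.sub_apply, e1, e2, e3]
  ring

end Compactness

/-! ### Passing to the limit in a strain. -/

section Strain

variable {Ω : Set Plane}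

/-- Cauchy–Schwarz in extended nonnegative form, since γ_j contains a product of L² functions and
need not itself lie in L². -/
theorem tendsto_integral_mul_of_lintegral_sq {μ : Measure Plane} {γ : ℕ → Plane → ℝ}
    (hγ : ∀ j, AEStronglyMeasurable (γ j) μ)
    (h0 : Tendsto (fun j => ∫⁻ z, ENNReal.ofReal ((γ j z) ^ 2) ∂μ) atTop (𝓝 0))
    {φ : Plane → ℝ} (hφ : MemLp φ 2 μ) :
    Tendsto (fun j => ∫ z, γ j z * φ z ∂μ) atTop (𝓝 0) := by
  have hsq : ∀ j, ∫⁻ z, ENNReal.ofReal ((γ j z) ^ 2) ∂μ = ∫⁻ z, ‖γ j z‖ₑ ^ (2 : ℝ) ∂μ := fun j => by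
    refine lintegral_congr fun z => ?_
    rw [← sq_abs, ENNReal.ofReal_pow (abs_nonneg _), ← Real.enorm_eq_ofReal_abs]
    simp
  simp_rw [hsq] at h0
  rw [tendsto_zero_iff_enorm_tendsto_zero]
  have hN : (∫⁻ z, ‖φ z‖ₑ ^ (2 : ℝ) ∂μ) ^ (1 / (2 : ℝ)) ≠ ⊤ := by
    have := hφ.eLpNorm_ne_top
    rwa [eLpNorm_eq_lintegral_rpow_enorm_toReal (by norm_num) (by norm_num)] at this
  have h1 : Tendsto (fun j => (∫⁻ z, ‖γ j z‖ₑ ^ (2 : ℝ) ∂μ) ^ (1 / (2 : ℝ)) *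
      (∫⁻ z, ‖φ z‖ₑ ^ (2 : ℝ) ∂μ) ^ (1 / (2 : ℝ))) atTop (𝓝 0) := by
    have h2 := ((ENNReal.continuous_rpow_const (y := 1 / 2)).tendsto _).comp h0
    have h3 := ENNReal.Tendsto.mul_const h2 (Or.inr hN)
    simpa [Function.comp_def] using h3
  refine tendsto_of_tendsto_of_tendsto_of_le_of_le tendsto_const_nhds h1 (fun _ => zero_le)
    fun j => ?_
  refine (enorm_integral_le_lintegral_enorm _).trans ?_
  simp_rw [enorm_mul]
  exact ENNReal.lintegral_mul_le_Lp_mul_Lq μ (by norm_num [Real.holderConjugate_iff])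
    (hγ j).enorm hφ.1.enorm

/-- A strain of the form `a + h k + p`, with the gradients of `h` bounded, vanishes in a weak limit
as soon as its `L²` norm tends to zero. -/
theorem ae_eq_zero_of_tendsto_lintegral_sq [IsFiniteMeasure (volume.restrict Ω)]
    (hΩ : IsOpen Ω) {a : ℕ → L2 Ω} {a₀ : L2 Ω} (ha : WeaklyTendsto a a₀)
    {h : ℕ → L2 Ω} {h₀ : L2 Ω} (hh : WeaklyTendsto h h₀)
    {d : Fin 2 → ℕ → L2 Ω} {d' : Fin 2 → L2 Ω}
    (H : ∀ i j, IsWeakPartial Ω i (h j) (d i j)) (H' : ∀ i, IsWeakPartial Ω i h₀ (d' i))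
    (hd : ∀ i, WeaklyTendsto (d i) (d' i)) {k : ℕ → L2 Ω} {k₀ : L2 Ω}
    (hk : WeaklyTendsto k k₀) {p : Plane → ℝ} (hp : Continuous p)
    {γ : ℕ → Plane → ℝ} {γ₀ : Plane → ℝ}
    (hγ : ∀ j, γ j =ᵐ[volume.restrict Ω] fun z => a j z + h j z * k j z + p z)
    (hγ₀ : γ₀ =ᵐ[volume.restrict Ω] fun z => a₀ z + h₀ z * k₀ z + p z)
    (h0 : Tendsto (fun j => ∫⁻ z in Ω, ENNReal.ofReal ((γ j z) ^ 2)) atTop (𝓝 0)) :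
    ∀ᵐ z ∂(volume.restrict Ω), γ₀ z = 0 := by
  have hm : ∀ j, AEStronglyMeasurable (γ j) (volume.restrict Ω) := fun j =>
    (((Lp.aestronglyMeasurable _).add ((Lp.aestronglyMeasurable _).mul
      (Lp.aestronglyMeasurable _))).add hp.aestronglyMeasurable).congr (hγ j).symm
  have hloc : LocallyIntegrableOn γ₀ Ω (volume.restrict Ω) := by
    have i1 : LocallyIntegrable (fun z => a₀ z + h₀ z * k₀ z + p z) (volume.restrict Ω) :=
      ((((Lp.memLp a₀).integrable (by norm_num)).add
        (integrable_mul h₀ (Lp.memLp k₀))).locallyIntegrable).add hp.locallyIntegrable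
    have i2 : LocallyIntegrable γ₀ (volume.restrict Ω) := by
      intro z
      obtain ⟨s, hs, hi⟩ := i1 z
      exact ⟨s, hs, hi.congr (ae_restrict_of_ae hγ₀.symm)⟩
    exact i2.locallyIntegrableOn _
  -- Fundamental lemma of the calculus of variations: only pairings with test functions matter.
  have key := hΩ.ae_eq_zero_of_integral_contDiff_smul_eq_zero hloc fun φ hs hc ht => ?_
  · filter_upwards [key, ae_restrict_mem hΩ.measurableSet] with z hz hzΩ using hz hzΩ
  have hφ : IsTestFunction Ω φ := ⟨hs, hc, ht⟩
  have hφ2 : MemLp φ 2 (volume.restrict Ω) :=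
    (hs.continuous.memLp_of_hasCompactSupport hc).restrict Ω
  have hpφ : Integrable (fun z => p z * φ z) (volume.restrict Ω) :=
    ((hp.mul hs.continuous).integrable_of_hasCompactSupport hc.mul_left).restrict
  have expand : ∀ (b w l : L2 Ω) (f : Plane → ℝ),
      f =ᵐ[volume.restrict Ω] (fun z => b z + w z * l z + p z) →
      ∫ z in Ω, f z * φ z = ((∫ z in Ω, b z * φ z) + ∫ z in Ω, w z * l z * φ z) +
        ∫ z in Ω, p z * φ z := by
    intro b w l f hf
    have i1 := hφ.integrable_mul b
    have i2 : Integrable (fun z => w z * l z * φ z) (volume.restrict Ω) := by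
      refine (integrable_mul w (hφ.memLp_mul l)).congr (Eventually.of_forall fun z => ?_)
      ring
    rw [← integral_add i1 i2]
    refine Eq.trans ?_ (integral_add (i1.add i2) hpφ)
    refine integral_congr_ae ?_
    filter_upwards [hf] with z hz
    rw [hz]
    ring
  have l1 := ((ha.integral_mul hφ2).add
    (tendsto_integral_mul_mul hΩ hh H H' hd hk hφ)).add_const (∫ z in Ω, p z * φ z)
  have l2 := tendsto_integral_mul_of_lintegral_sq hm h0 hφ2
  simp_rw [expand _ _ _ _ (hγ _)] at l2
  have := tendsto_nhds_unique l1 l2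
  rw [← expand _ _ _ _ hγ₀] at this
  simpa only [smul_eq_mul, mul_comm] using this

end Strain

/-! ### Configurations, energies and the two inequalities. -/

section Energies

variable {R : ℝ}

theorem isFiniteMeasure_disk : IsFiniteMeasure (volume.restrict (disk R)) :=
  ⟨by simpa using measure_ball_lt_top (μ := volume) (x := (0 : Plane)) (r := R)⟩

/-- Weak convergence of a sequence of configurations, tested on continuous linear functionals. -/
def ConfigWeaklyTendsto (y : ℕ → Config R) (x : Config R) : Prop :=
  ∀ ℓ : Config R →L[ℝ] ℝ, Tendsto (fun j => ℓ (y j)) atTop (𝓝 (ℓ x))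

theorem configWeaklyTendsto_of_tendsto {y : ℕ → WeakSpace ℝ (Config R)}
    {x : WeakSpace ℝ (Config R)} (h : Tendsto y atTop (𝓝 x)) :
    ConfigWeaklyTendsto (fun j => (toWeakSpace ℝ (Config R)).symm (y j))
      ((toWeakSpace ℝ (Config R)).symm x) := fun ℓ =>
  ((WeakBilin.eval_continuous (topDualPairing ℝ (Config R)).flip ℓ).tendsto x).comp h

theorem ConfigWeaklyTendsto.comp {y : ℕ → Config R} {x : Config R} (h : ConfigWeaklyTendsto y x)
    {σ : ℕ → ℕ} (hσ : StrictMono σ) : ConfigWeaklyTendsto (fun j => y (σ j)) x :=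
  fun ℓ => (h ℓ).comp hσ.tendsto_atTop

theorem ConfigWeaklyTendsto.map {y : ℕ → Config R} {x : Config R} (h : ConfigWeaklyTendsto y x)
    (T : Config R →L[ℝ] L2 (disk R)) : WeaklyTendsto (fun j => T (y j)) (T x) :=
  fun v => h ((innerSL ℝ v).comp T)

/-- `∂_i f` as a continuous linear function of the configuration. -/
def dfL (i : Fin 2) : Config R →L[ℝ] L2 (disk R) where
  toFun x := W12.d i x.1
  map_add' _ _ := rfl
  map_smul' _ _ := rfl
  cont := by unfold W12.d; fun_prop

/-- `∂_i g` as a continuous linear function of the configuration. -/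
def dgL (i : Fin 2) : Config R →L[ℝ] L2 (disk R) where
  toFun x := W12.d i x.2.1
  map_add' _ _ := rfl
  map_smul' _ _ := rfl
  cont := by unfold W12.d; fun_prop

/-- `∂_i ω` as a continuous linear function of the configuration. -/
def dωL (i : Fin 2) : Config R →L[ℝ] L2 (disk R) where
  toFun x := W22.d i x.2.2
  map_add' _ _ := rfl
  map_smul' _ _ := rfl
  cont := by unfold W22.d; fun_prop

/-- `∂_j ∂_i ω` as a continuous linear function of the configuration. -/
def ddωL (i j : Fin 2) : Config R →L[ℝ] L2 (disk R) where
  toFun x := W22.dd i j x.2.2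
  map_add' _ _ := rfl
  map_smul' _ _ := rfl
  cont := by unfold W22.dd; fun_prop

/-- Each squared strain is dominated by the stretching density, and its quadratic part is a product
of derivatives ∂_i ω, whose own gradients D²ω converge weakly. -/
theorem strainFree_of_tendsto_stretching {y : ℕ → Config R} {x : Config R}
    (h : ConfigWeaklyTendsto y x) (h0 : Tendsto (fun j => stretching (y j)) atTop (𝓝 0)) :
    StrainFree x := by
  have := isFiniteMeasure_disk (R := R)
  have hz : ∀ f : Config R → Plane → ℝ, (∀ x z, (f x z) ^ 2 ≤
      (gamma11 x z) ^ 2 + 2 * (gamma12 x z) ^ 2 + (gamma22 x z) ^ 2) →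
      Tendsto (fun j => ∫⁻ z in disk R, ENNReal.ofReal ((f (y j) z) ^ 2)) atTop (𝓝 0) :=
    fun f hf => tendsto_of_tendsto_of_tendsto_of_le_of_le tendsto_const_nhds h0
      (fun _ => zero_le) fun j => lintegral_mono fun z => ENNReal.ofReal_le_ofReal (hf _ _)
  have H : ∀ (l : Fin 2) (x : Config R) (i : Fin 2),
      IsWeakPartial (disk R) i (dωL l x) (ddωL l i x) := fun l x i => x.2.2.2.2 l i
  refine ⟨?_, ?_, ?_⟩
  · have e : ∀ x : Config R, gamma11 x =ᵐ[volume.restrict (disk R)] fun z =>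
        ((2 : ℝ) • dfL 0 : Config R →L[ℝ] L2 (disk R)) x z + dωL 0 x z * dωL 0 x z + -(z 1 ^ 2 / 3) := fun x => by
      filter_upwards [Lp.coeFn_smul (2 : ℝ) (dfL 0 x)] with z hz
      have : ((2 : ℝ) • dfL 0 : Config R →L[ℝ] L2 (disk R)) x z = 2 * dfL 0 x z := hz
      rw [this]
      change 2 * dfL 0 x z + (dωL 0 x z) ^ 2 - (z 1) ^ 2 / 3 = _
      ring
    exact ae_eq_zero_of_tendsto_lintegral_sq Metric.isOpen_ball (h.map ((2 : ℝ) • dfL 0))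
      (h.map (dωL 0)) (fun i j => H 0 (y j) i) (H 0 x) (fun i => h.map (ddωL 0 i))
      (h.map (dωL 0)) (by fun_prop) (fun j => e (y j)) (e x)
      (hz gamma11 fun x z => by nlinarith [sq_nonneg (gamma12 x z), sq_nonneg (gamma22 x z)])
  · have e : ∀ x : Config R, gamma12 x =ᵐ[volume.restrict (disk R)] fun z =>
        (dfL 1 + dgL 0 : Config R →L[ℝ] L2 (disk R)) x z + dωL 0 x z * dωL 1 x z + z 0 * z 1 / 3 := fun x => by
      filter_upwards [Lp.coeFn_add (dfL 1 x) (dgL 0 x)] with z hz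
      have : (dfL 1 + dgL 0 : Config R →L[ℝ] L2 (disk R)) x z = dfL 1 x z + dgL 0 x z := hz
      rw [this]
      rfl
    exact ae_eq_zero_of_tendsto_lintegral_sq Metric.isOpen_ball (h.map (dfL 1 + dgL 0))
      (h.map (dωL 0)) (fun i j => H 0 (y j) i) (H 0 x) (fun i => h.map (ddωL 0 i))
      (h.map (dωL 1)) (by fun_prop) (fun j => e (y j)) (e x)
      (hz gamma12 fun x z => by
        nlinarith [sq_nonneg (gamma11 x z), sq_nonneg (gamma12 x z), sq_nonneg (gamma22 x z)])
  · have e : ∀ x : Config R, gamma22 x =ᵐ[volume.restrict (disk R)] fun z =>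
        ((2 : ℝ) • dgL 1 : Config R →L[ℝ] L2 (disk R)) x z + dωL 1 x z * dωL 1 x z + -(z 0 ^ 2 / 3) := fun x => by
      filter_upwards [Lp.coeFn_smul (2 : ℝ) (dgL 1 x)] with z hz
      have : ((2 : ℝ) • dgL 1 : Config R →L[ℝ] L2 (disk R)) x z = 2 * dgL 1 x z := hz
      rw [this]
      change 2 * dgL 1 x z + (dωL 1 x z) ^ 2 - (z 0) ^ 2 / 3 = _
      ring
    exact ae_eq_zero_of_tendsto_lintegral_sq Metric.isOpen_ball (h.map ((2 : ℝ) • dgL 1))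
      (h.map (dωL 1)) (fun i j => H 1 (y j) i) (H 1 x) (fun i => h.map (ddωL 1 i))
      (h.map (dωL 1)) (by fun_prop) (fun j => e (y j)) (e x)
      (hz gamma22 fun x z => by nlinarith [sq_nonneg (gamma11 x z), sq_nonneg (gamma12 x z)])

theorem integral_sq_eq_norm_sq {Ω : Set Plane} (w : L2 Ω) : ∫ z in Ω, (w z) ^ 2 = ‖w‖ ^ 2 := by
  rw [← real_inner_self_eq_norm_sq, L2.inner_def]
  simp [sq]

theorem bending_eq (w : W22 (disk R)) :
    bending w = ENNReal.ofReal (∑ i : Fin 2, ∑ j : Fin 2, ‖W22.dd i j w‖ ^ 2) := by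
  have hi : ∀ i j, Integrable (fun z => (W22.dd i j w z) ^ 2) (volume.restrict (disk R)) :=
    fun i j => (Lp.memLp _).integrable_sq
  rw [bending, ← ofReal_integral_eq_lintegral_ofReal]
  · rw [integral_finsetSum _ fun i _ => integrable_finsetSum _ fun j _ => hi i j]
    simp_rw [integral_finsetSum _ fun j _ => hi _ j, integral_sq_eq_norm_sq]
  · exact integrable_finsetSum _ fun i _ => integrable_finsetSum _ fun j _ => hi i j
  · exact Eventually.of_forall fun z => Finset.sum_nonneg fun i _ =>
      Finset.sum_nonneg fun j _ => sq_nonneg _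

/-- The bending energy is weakly sequentially lower semicontinuous. -/
theorem bending_le_liminf {y : ℕ → Config R} {x : Config R} (h : ConfigWeaklyTendsto y x) :
    bending x.2.2 ≤ liminf (fun j => bending (y j).2.2) atTop := by
  -- The tangent bound 2⟨a, b⟩ - ‖a‖² ≤ ‖b‖² is weakly continuous in b and an equality at b = a.
  have h1 : Tendsto (fun n => ENNReal.ofReal (∑ i : Fin 2, ∑ j : Fin 2,
      (2 * inner ℝ (ddωL i j x) (ddωL i j (y n)) - ‖ddωL i j x‖ ^ 2))) atTop
      (𝓝 (ENNReal.ofReal (∑ i : Fin 2, ∑ j : Fin 2,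
        (2 * inner ℝ (ddωL i j x) (ddωL i j x) - ‖ddωL i j x‖ ^ 2)))) :=
    ENNReal.tendsto_ofReal (tendsto_finsetSum _ fun i _ => tendsto_finsetSum _ fun j _ =>
      ((h.map (ddωL i j) _).const_mul 2).sub_const _)
  have h2 : bending x.2.2 = ENNReal.ofReal (∑ i : Fin 2, ∑ j : Fin 2,
        (2 * inner ℝ (ddωL i j x) (ddωL i j x) - ‖ddωL i j x‖ ^ 2)) := by
    rw [bending_eq]
    congr 1
    refine Finset.sum_congr rfl fun i _ => Finset.sum_congr rfl fun j _ => ?_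
    rw [real_inner_self_eq_norm_sq]
    change ‖ddωL i j x‖ ^ 2 = _
    ring
  rw [h2, ← h1.liminf_eq]
  refine liminf_le_liminf (Eventually.of_forall fun n => ?_)
  rw [bending_eq]
  refine ENNReal.ofReal_le_ofReal
    (Finset.sum_le_sum fun i _ => Finset.sum_le_sum fun j _ => ?_)
  change _ ≤ ‖ddωL i j (y n)‖ ^ 2
  have := norm_sub_sq_real (ddωL i j x) (ddωL i j (y n))
  nlinarith [sq_nonneg ‖ddωL i j x - ddωL i j (y n)‖]

theorem scaledEnergy_eq {t : ℝ} (ht : 0 < t) (x : Config R) :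
    scaledEnergy t x = ENNReal.ofReal ((t ^ 2)⁻¹) * stretching x + bending x.2.2 := by
  rw [scaledEnergy, elasticEnergy, mul_add, ← mul_assoc, ← ENNReal.ofReal_mul (by positivity),
    inv_mul_cancel₀ (by positivity), ENNReal.ofReal_one, one_mul]

theorem stretching_le {t : ℝ} (ht : 0 < t) (x : Config R) :
    stretching x ≤ ENNReal.ofReal (t ^ 2) * scaledEnergy t x := by
  rw [scaledEnergy, elasticEnergy, ← mul_assoc, ← ENNReal.ofReal_mul (by positivity),
    mul_inv_cancel₀ (by positivity), ENNReal.ofReal_one, one_mul]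
  exact le_self_add

theorem StrainFree.stretching_eq_zero {x : Config R} (hx : StrainFree x) : stretching x = 0 := by
  rw [stretching, ← lintegral_zero (μ := volume.restrict (disk R))]
  refine lintegral_congr_ae ?_
  filter_upwards [hx.1, hx.2.1, hx.2.2] with z h1 h2 h3
  simp [h1, h2, h3]

theorem limitEnergy_le_liminf {t : ℕ → ℝ} (ht : ∀ j, 0 < t j) (ht0 : Tendsto t atTop (𝓝 0))
    {y : ℕ → Config R} {x : Config R} (h : ConfigWeaklyTendsto y x) :
    limitEnergy x ≤ liminf (fun j => scaledEnergy (t j) (y j)) atTop := by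
  by_cases hx : StrainFree x
  · rw [limitEnergy, if_pos hx]
    refine (bending_le_liminf h).trans (liminf_le_liminf (Eventually.of_forall fun j => ?_))
    rw [scaledEnergy_eq (ht j)]
    exact le_add_self
  by_contra hlt
  rw [not_le] at hlt
  -- C lies strictly below F_0, hence is finite, and the energies fall below C infinitely often; on
  -- that subsequence S ≤ t² C.
  obtain ⟨C, hC, hC'⟩ := exists_between hlt
  obtain ⟨σ, hσ, hσC⟩ := extraction_of_frequently_atTop (frequently_lt_of_liminf_lt (h := hC))
  refine hx (strainFree_of_tendsto_stretching (h.comp hσ) ?_)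
  have h1 : Tendsto (fun j => ENNReal.ofReal (t (σ j) ^ 2) * C) atTop (𝓝 0) := by
    have h2 : Tendsto (fun j => ENNReal.ofReal (t (σ j) ^ 2)) atTop (𝓝 0) := by
      simpa using ENNReal.tendsto_ofReal ((ht0.comp hσ.tendsto_atTop).pow 2)
    simpa using ENNReal.Tendsto.mul_const h2 (Or.inr (hC'.trans_le le_top).ne)
  refine tendsto_of_tendsto_of_tendsto_of_le_of_le tendsto_const_nhds h1 (fun _ => zero_le)
    fun j => (stretching_le (ht (σ j)) _).trans ?_
  gcongr
  exact (hσC j).le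

theorem limsup_scaledEnergy_le {t : ℕ → ℝ} (ht : ∀ j, 0 < t j) (x : Config R) :
    limsup (fun j => scaledEnergy (t j) x) atTop ≤ limitEnergy x := by
  by_cases hx : StrainFree x
  · simp [scaledEnergy_eq (ht _), hx.stretching_eq_zero, limitEnergy, hx]
  · simp [limitEnergy, hx]

end Energies

end SmallSlopes

end

theorem mainTheorem3 (R : ℝ) (hR : 0 < R) :
    SmallSlopes.GammaTendsto (X := WeakSpace ℝ (SmallSlopes.Config R))
      (fun t x => SmallSlopes.scaledEnergy t ((toWeakSpace ℝ (SmallSlopes.Config R)).symm x))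
      (fun x => SmallSlopes.limitEnergy ((toWeakSpace ℝ (SmallSlopes.Config R)).symm x)) := by
  intro t ht ht0 x
  exact ⟨fun y hy => SmallSlopes.limitEnergy_le_liminf ht ht0
      (SmallSlopes.configWeaklyTendsto_of_tendsto hy),
    fun _ => x, tendsto_const_nhds, SmallSlopes.limsup_scaledEnergy_le ht _⟩
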